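/- An ordered differential field is an ordered field $K$ with a derivation $\partial\colon K\to K$, $a\mapsto a'$; its constant field is $C=\{a\in K: a'=0\}$. It is an $H$-field if (H1) $a'>0$ for every $a\in K$ with $a>C$, and (H2) $\mathcal O=C+\mathfrak{o}$, where $\mathcal O$ is the convex hull of $C$ in $K$ (a valuation ring of $K$) and $\mathfrak{o}$ is the maximal ideal of $\mathcal O$; an $H$-field is viewed as an ordered valued differential field with valuation ring this $\mathcal O$. A pre-$H$-field is an ordered valued differential subfield of an $H$-field. Let $K$ be a pre-$H$-field with valuation ring $\mathcal O$, maximal ideal $\mathfrak{o}$ of $\mathcal O$, and valuation $v\colon K^\times\to\Gamma$ (additive, extended by $v(0)=\infty$). * $K$ has $1$-IVP if for every differential polynomial $P(Y)\in K[Y,Y']$ and all $f<g$ in $K$ with $P(f)<0<P(g)$ there is $\phi\in K$ with $f<\phi<g$ and $P(\phi)=0$. * For $g\in K^\times$ with $\gamma=v(g)\neq 0$ put $\psi(\gamma)=v(g'/g)$; let $\Psi=\{\psi(\gamma):\gamma\in\Gamma,\ \gamma\ne0\}$ and $(\Gamma^{>})'=\{\gamma+\psi(\gamma):\gamma\in\Gamma,\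 \gamma>0\}$. A gap in $K$ is an element $\beta\in\Gamma$ with $\Psi<\beta<(\Gamma^{>})'$. (In particular, if $\Gamma=\{0\}$, then $0$ is a gap.) **Lemma 1.2.** Suppose the pre-$H$-field $K$ has $1$-IVP and has no gap. Then $K$ is an $H$-field, and its valuation ring $\mathcal O$ is the convex hull of its constant field. Moreover, $\mathrm I(K)=\partial\mathfrak{o}$, where $\mathrm I(K):=\{y\in K: v(y)\geq v(f')\text{ for some } f\in\mathcal O\}$ and $\partial\mathfrak{o}:=\{a': a\in\mathfrak{o}\}$. -/

import Mathlib

open scoped Differential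

universe u w

namespace HFieldIVP

section OrderedDifferentialField

variable (K : Type u) [Field K] [LinearOrder K] [IsStrictOrderedRing K] [Differential K]

/-- The convex hull of the constant field `C = {c | c′ = 0}` in an ordered differential field,
which is a valuation ring of the field. -/
def constHull : ValuationSubring K where
  carrier := {a | ∃ c d : K, c′ = 0 ∧ d′ = 0 ∧ c ≤ a ∧ a ≤ d}
  mul_mem' := by
    rintro a b ⟨c, d, hc, hd, hca, had⟩ ⟨c', d', hc', hd', hcb, hbd⟩
    have key : ∀ x y z : K, x′ = 0 → y′ = 0 → x ≤ z → z ≤ y → ∃ e : K, e′ = 0 ∧ |z| ≤ e := by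
      intro x y z hx hy hxz hzy
      refine ⟨max (-x) y, ?_, ?_⟩
      · rcases max_choice (-x) y with h | h <;> rw [h] <;> simp [hx, hy]
      · exact abs_le'.2 ⟨hzy.trans (le_max_right _ _), (neg_le_neg hxz).trans (le_max_left _ _)⟩
    obtain ⟨e, he, hae⟩ := key c d a hc hd hca had
    obtain ⟨e', he', hbe⟩ := key c' d' b hc' hd' hcb hbd
    have h : |a * b| ≤ e * e' := by
      rw [abs_mul]
      exact mul_le_mul hae hbe (abs_nonneg b) ((abs_nonneg a).trans hae)
    exact ⟨-(e * e'), e * e', by simp [he, he'], by simp [he, he'],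
      (abs_le.1 h).1, (abs_le.1 h).2⟩
  one_mem' := ⟨1, 1, by simp, by simp, le_rfl, le_rfl⟩
  add_mem' := by
    rintro a b ⟨c, d, hc, hd, hca, had⟩ ⟨c', d', hc', hd', hcb, hbd⟩
    exact ⟨c + c', d + d', by simp [hc, hc'], by simp [hd, hd'],
      add_le_add hca hcb, add_le_add had hbd⟩
  zero_mem' := ⟨0, 0, by simp, by simp, le_rfl, le_rfl⟩
  neg_mem' := by
    rintro a ⟨c, d, hc, hd, hca, had⟩
    exact ⟨-d, -c, by simp [hd], by simp [hc], neg_le_neg had, neg_le_neg hca⟩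
  mem_or_inv_mem' := by
    intro a
    by_cases h : |a| ≤ 1
    · exact Or.inl ⟨-1, 1, by simp, by simp, (abs_le.1 h).1, (abs_le.1 h).2⟩
    · have h' : |a⁻¹| ≤ 1 := by
        rw [abs_inv]
        exact inv_le_one_of_one_le₀ (le_of_lt (not_le.1 h))
      exact Or.inr ⟨-1, 1, by simp, by simp, (abs_le.1 h').1, (abs_le.1 h').2⟩

/-- An ordered differential field `K` with constant field `C` is an `H`-field if
(H1) every element greater than all constants has positive derivative, and
(H2) `𝒪 = C + 𝓸`, where `𝒪` is the convex hull of `C` and `𝓸` is the maximal ideal of `𝒪`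
(an element of `𝒪` lies in `𝓸` if and only if it is not a unit of `𝒪`). -/
structure IsHField : Prop where
  deriv_pos : ∀ a : K, (∀ c : K, c′ = 0 → c < a) → 0 < (a′)
  eq_const_add : ∀ a ∈ constHull K, ∃ c : K, c′ = 0 ∧ ∃ e ∈ (constHull K).nonunits, a = c + e

/-- An ordered valued differential field `K` (with valuation ring `O`) is a pre-`H`-field if it is
(isomorphic to) an ordered valued differential subfield of some `H`-field `L`, the latter
carrying the valuation whose valuation ring is the convex hull of its constant field. -/
def IsPreHField (O : ValuationSubring K) : Prop :=
  ∃ (L : Type w) (_ : Field L) (_ : LinearOrder L) (_ : IsStrictOrderedRing L)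
    (_ : Differential L) (i : K →+* L),
    IsHField L ∧ StrictMono i ∧ (∀ a : K, i (a′) = (i a)′) ∧
      ∀ a : K, a ∈ O ↔ i a ∈ constHull L

/-- `r`-IVP: whenever `P` is a differential polynomial of order at most `r` over `K`, and `f < g`
satisfy `P(f) < 0 < P(g)`, there is `y` with `f < y < g` and `P(y) = 0`.
A differential polynomial of order at most `r` is a polynomial in the `r + 1` indeterminates
`Y, Y′, …, Y^(r)`, evaluated at `y` by substituting `y, y′, …, y^(r)`. -/
def HasOrderIVP (r : ℕ) : Prop :=
  let ev : K → MvPolynomial (Fin (r + 1)) K → K :=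
    fun y P => MvPolynomial.eval (fun j : Fin (r + 1) => (fun z : K => z′)^[(j : ℕ)] y) P
  ∀ (P : MvPolynomial (Fin (r + 1)) K) (f g : K), f < g → ev f P < 0 → 0 < ev g P →
    ∃ y : K, f < y ∧ y < g ∧ ev y P = 0

end OrderedDifferentialField

section ValuedDifferentialField

variable {K : Type u} [Field K]

/-- The valuation `v : K → Γ ∪ {∞}` of the valuation ring `O`, written additively, so that
`O = {a | 0 ≤ v a}`. -/
noncomputable def val (O : ValuationSubring K) : AddValuation K (Additive O.ValueGroup)ᵒᵈ :=
  O.valuation.toAddValuation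

variable [Differential K]

/-- The set `Ψ = {ψ(γ) : γ ∈ Γ, γ ≠ 0}` of the asymptotic couple `(Γ, ψ)` of `K`, where
`ψ(v g) = v(g′/g)` for nonzero `g` with `v g ≠ 0`. -/
def psiSet (O : ValuationSubring K) : Set (Additive O.ValueGroup)ᵒᵈ :=
  {δ | ∃ g : K, g ≠ 0 ∧ val O g ≠ 0 ∧ δ = val O (g′ / g)}

/-- The set `(Γ^>)′ = {γ + ψ(γ) : γ ∈ Γ, γ > 0}` of the asymptotic couple `(Γ, ψ)` of `K`. -/
def posDerivSet (O : ValuationSubring K) : Set (Additive O.ValueGroup)ᵒᵈ :=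
  {δ | ∃ g : K, g ≠ 0 ∧ 0 < val O g ∧ δ = val O g + val O (g′ / g)}

/-- `K` has a gap: there is `β` in `Γ` with `Ψ < β < (Γ^>)′`. -/
def HasGap (O : ValuationSubring K) : Prop :=
  ∃ β : (Additive O.ValueGroup)ᵒᵈ, β ≠ ⊤ ∧
    (∀ δ ∈ psiSet O, δ < β) ∧ ∀ δ ∈ posDerivSet O, β < δ

/-- `I(K) = {y | y ≼ f′ for some f ∈ 𝒪}`, where `a ≼ b` means `v a ≥ v b`. -/
def integralSet (O : ValuationSubring K) : Set K :=
  {y | ∃ f ∈ O, val O (f′) ≤ val O y}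

end ValuedDifferentialField

end HFieldIVP

namespace HFieldIVP

/-! ### Convex hull of the constants and derivatives in an `H`-field -/

section ConvexHull

variable {L : Type*} [Field L] [LinearOrder L] [IsStrictOrderedRing L] [Differential L]

/-! Everything reduces to solving `y′ = s` in `𝓸` for each nonzero `s ∈ I(K)`. By an inequality
inherited from the ambient `H`-field (`valuation_deriv_lt`), `Ψ < v s`. As `v s` is not a gap, some
`g > 0` in `𝓸` has `v(g′) ≤ v s`. Write `g = h²`, the root coming from IVP: since `g′ = 2hh′` with
`h ∈ 𝓸`, `v(h′) < v s`, so `|s| < -h′`. Then `s - Y′` changes sign between `-h` and `h`, and 1-IVP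
gives a zero `y`, which lies in `𝓸` by convexity. Applied to `s = f′` with `f ∈ O`, this makes `f -
y` constant, so `O = C + 𝓸`; hence `O` is the convex hull of `C`, and (H1) descends from the
`H`-field. -/

omit [IsStrictOrderedRing L] in
theorem abs_deriv_eq_zero {c : L} (hc : c′ = 0) : |c|′ = 0 := by
  rcases abs_choice c with h | h <;> rw [h] <;> simp [hc]

theorem mem_constHull_iff {a : L} : a ∈ constHull L ↔ ∃ c : L, c′ = 0 ∧ |a| ≤ c := by
  constructor
  · rintro ⟨c, d, hc, hd, hca, had⟩
    refine ⟨|c| + |d|, by simp [abs_deriv_eq_zero hc, abs_deriv_eq_zero hd], abs_le.2 ⟨?_, ?_⟩⟩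
    · linarith [neg_abs_le c, abs_nonneg d]
    · linarith [le_abs_self d, abs_nonneg c]
  · rintro ⟨c, hc, h⟩
    exact ⟨-c, c, by simp [hc], hc, (abs_le.1 h).1, (abs_le.1 h).2⟩

theorem mem_constHull_of_abs_le {a b : L} (ha : a ∈ constHull L) (h : |b| ≤ |a|) :
    b ∈ constHull L := by
  obtain ⟨c, hc, hac⟩ := mem_constHull_iff.1 ha
  exact mem_constHull_iff.2 ⟨c, hc, h.trans hac⟩

omit [LinearOrder L] [IsStrictOrderedRing L] in
theorem deriv_inv_eq_zero {c : L} (hc : c′ = 0) : (c⁻¹)′ = 0 := by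
  rw [Derivation.leibniz_inv, hc, smul_zero]

theorem mem_constHull_nonunits_iff {a : L} :
    a ∈ (constHull L).nonunits ↔ ∀ c : L, c′ = 0 → 0 < c → |a| < c := by
  rw [ValuationSubring.mem_nonunits_iff_or]
  constructor
  · rintro (rfl | h) c hc hc0
    · simpa using hc0
    · by_contra! hca
      refine h (mem_constHull_iff.2 ⟨c⁻¹, deriv_inv_eq_zero hc, ?_⟩)
      rw [abs_inv]
      exact inv_anti₀ hc0 hca
  · intro h
    by_contra! hn
    obtain ⟨c, hc, hac⟩ := mem_constHull_iff.1 hn.2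
    have ha : 0 < |a⁻¹| := abs_pos.2 (inv_ne_zero hn.1)
    have := h c⁻¹ (deriv_inv_eq_zero hc) (inv_pos.2 (ha.trans_le hac))
    rw [abs_inv] at hac ha
    exact absurd ((inv_le_comm₀ (abs_pos.2 hn.1) (ha.trans_le hac)).1 hac) this.not_ge

theorem lt_of_notMem_constHull {h c : L} (hh : h ∉ constHull L) (h0 : 0 < h) (hc : c′ = 0) :
    c < h := by
  by_contra! hle
  exact hh (mem_constHull_iff.2 ⟨c, hc, by rwa [abs_of_pos h0]⟩)

theorem IsHField.deriv_pos_of_notMem (hL : IsHField L) {h : L} (hh : h ∉ constHull L)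
    (h0 : 0 < h) : 0 < h′ :=
  hL.deriv_pos h fun _ hc => lt_of_notMem_constHull hh h0 hc

/-- If `e` is infinitesimal and `h` is infinite, then `h * (c + e)` is infinite for every constant
`c > 0`, so that its derivative is positive. -/
theorem IsHField.neg_mul_deriv_lt (hL : IsHField L) {h e c : L} (hh : h ∉ constHull L)
    (h0 : 0 < h) (he : e ∈ (constHull L).nonunits) (hc : c′ = 0) (hc0 : 0 < c) :
    -(h * e′) < 2 * c * h′ := by
  have hh' := hL.deriv_pos_of_notMem hh h0
  have h2 : (2 : L)′ = 0 := by simpa using Derivation.map_natCast (Differential.deriv (R := L)) 2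
  rw [mem_constHull_nonunits_iff] at he
  have hc2 : (c / 2)′ = 0 := by rw [Derivation.leibniz_div_const _ _ _ h2, hc, smul_zero]
  have hec := abs_lt.1 (he (c / 2) hc2 (by positivity))
  have key : 0 < (h * (c + e))′ := by
    refine hL.deriv_pos _ fun d hd => ?_
    have hdc : (d * (c / 2)⁻¹)′ = 0 := by
      rw [Derivation.leibniz, hd, deriv_inv_eq_zero hc2, smul_zero, smul_zero, add_zero]
    calc d = d * (c / 2)⁻¹ * (c / 2) := by field_simp
      _ < h * (c / 2) := by
        have := lt_of_notMem_constHull hh h0 hdc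
        gcongr
      _ < h * (c + e) := by
        gcongr
        linarith
  rw [Derivation.leibniz, map_add, hc, zero_add, smul_eq_mul, smul_eq_mul] at key
  -- `key` says `-h e′ < (c + e) h′`, and `e < c`.
  nlinarith

/-- Write `f = c + e`, so `f′ = e′`; the preceding bound for both `e` and `-e` gives `|h e′| < d h′`
for every constant `d > 0`. -/
theorem IsHField.deriv_mul_div_mem_nonunits (hL : IsHField L) {f h : L} (hf : f ∈ constHull L)
    (hh : h ∉ constHull L) : h′ ≠ 0 ∧ f′ * (h / h′) ∈ (constHull L).nonunits := by
  wlog h0 : 0 < h generalizing h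
  · have hne : h ≠ 0 := fun h => hh (h ▸ zero_mem _)
    have := this (h := -h) (by simpa using hh)
      (neg_pos.2 (lt_of_le_of_ne (not_lt.1 h0) hne))
    simpa [neg_div_neg_eq] using this
  have hh' := hL.deriv_pos_of_notMem hh h0
  refine ⟨hh'.ne', ?_⟩
  obtain ⟨c, hc, e, he, rfl⟩ := hL.eq_const_add f hf
  rw [mem_constHull_nonunits_iff]
  intro d hd hd0
  have h2 : (2 : L)′ = 0 := by simpa using Derivation.map_natCast (Differential.deriv (R := L)) 2
  have hd2 : (d / 2)′ = 0 := by rw [Derivation.leibniz_div_const _ _ _ h2, hd, smul_zero]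
  have h1 := hL.neg_mul_deriv_lt hh h0 he hd2 (by positivity)
  have h3 := hL.neg_mul_deriv_lt hh h0 (neg_mem he) hd2 (by positivity)
  rw [map_neg] at h3
  rw [map_add, hc, zero_add, ← mul_div_assoc, abs_div, abs_of_pos hh', div_lt_iff₀ hh', abs_lt]
  constructor <;> linarith

end ConvexHull

/-! ### Pre-`H`-fields, then consequences of IVP and the absence of a gap -/

section PreHField

variable {K : Type u} [Field K] [LinearOrder K] [IsStrictOrderedRing K] [Differential K]
  {O : ValuationSubring K}

theorem IsPreHField.mem_of_abs_le (hK : IsPreHField.{u, w} K O) {a b : K} (ha : a ∈ O)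
    (h : |b| ≤ |a|) : b ∈ O := by
  obtain ⟨L, _, _, _, _, i, -, hi, -, hO⟩ := hK
  rw [hO] at ha ⊢
  refine mem_constHull_of_abs_le ha ?_
  have habs (x : K) : |i x| = i |x| := by
    rcases le_total 0 x with h | h
    · rw [abs_of_nonneg h, abs_of_nonneg (by simpa using hi.monotone h)]
    · rw [abs_of_nonpos h, abs_of_nonpos (by simpa using hi.monotone h), map_neg]
  rw [habs, habs]
  exact hi.monotone h

omit [IsStrictOrderedRing K] in
theorem IsPreHField.mem_of_deriv_eq_zero (hK : IsPreHField.{u, w} K O) {c : K} (hc : c′ = 0) :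
    c ∈ O := by
  obtain ⟨L, _, _, _, _, i, -, -, hd, hO⟩ := hK
  rw [hO]
  exact mem_constHull_iff.2 ⟨|i c|, abs_deriv_eq_zero (by rw [← hd, hc, map_zero]), le_rfl⟩

omit [IsStrictOrderedRing K] in
theorem IsPreHField.deriv_pos (hK : IsPreHField.{u, w} K O) {a : K} (ha : a ∉ O)
    (h0 : 0 < a) : 0 < a′ := by
  obtain ⟨L, _, _, _, _, i, hL, hi, hd, hO⟩ := hK
  rw [hO] at ha
  rw [← hi.lt_iff_lt, map_zero, hd]
  exact hL.deriv_pos_of_notMem ha (by simpa using hi h0)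

omit [IsStrictOrderedRing K] in
theorem IsPreHField.valuation_deriv_lt (hK : IsPreHField.{u, w} K O) {f g : K} (hf : f ∈ O)
    (hg : g ∉ O) : O.valuation (f′) < O.valuation (g′ / g) := by
  have key : g′ ≠ 0 ∧ f′ * (g / g′) ∈ O.nonunits := by
    obtain ⟨L, _, _, _, _, i, hL, hi, hd, hO⟩ := hK
    have := hL.deriv_mul_div_mem_nonunits ((hO f).1 hf) (mt (hO g).2 hg)
    rw [← hd, ← hd, ← map_div₀, ← map_mul] at this
    refine ⟨fun h => this.1 (by rw [h, map_zero]), ?_⟩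
    have h2 := this.2
    rw [ValuationSubring.mem_nonunits_iff_or] at h2 ⊢
    rwa [map_eq_zero, ← map_inv₀, ← hO] at h2
  have hg0 : g ≠ 0 := fun h => hg (h ▸ zero_mem _)
  have hpos : 0 < O.valuation (g′ / g) := by
    rw [zero_lt_iff, Valuation.ne_zero_iff]
    exact div_ne_zero key.1 hg0
  have := key.2
  rwa [← inv_div, ← div_eq_mul_inv, ValuationSubring.mem_nonunits_iff, map_div₀,
    div_lt_one₀ hpos] at this

-- Passing to `g⁻¹` only changes the sign of `g′/g`, so `g ∉ O` may be assumed.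
omit [IsStrictOrderedRing K] in
theorem IsPreHField.valuation_deriv_lt_of_ne_one (hK : IsPreHField.{u, w} K O) {f g : K}
    (hf : f ∈ O) (hg0 : g ≠ 0) (hg : O.valuation g ≠ 1) :
    O.valuation (f′) < O.valuation (g′ / g) := by
  rcases lt_or_gt_of_ne hg with h | h
  · have hinv : g⁻¹ ∉ O :=
      (O.mem_nonunits_iff_or.1 (O.mem_nonunits_iff.2 h)).resolve_left hg0
    have := hK.valuation_deriv_lt hf hinv
    rwa [show (g⁻¹)′ / g⁻¹ = -(g′ / g) by
      rw [Derivation.leibniz_inv, smul_eq_mul]; field_simp, Valuation.map_neg] at this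
  · exact hK.valuation_deriv_lt hf fun hO => h.not_ge ((O.valuation_le_one_iff g).2 hO)

theorem IsPreHField.valuation_mono (hK : IsPreHField.{u, w} K O) {a b : K} (h : |b| ≤ |a|) :
    O.valuation b ≤ O.valuation a := by
  rcases eq_or_ne a 0 with rfl | ha
  · have : b = 0 := by simpa using h
    rw [this]
  have : b / a ∈ O := by
    refine hK.mem_of_abs_le O.one_mem ?_
    rw [abs_div, abs_one]
    exact div_le_one_of_le₀ h (abs_nonneg a)
  exact (O.valuation_le_iff b a).2 ⟨⟨b / a, this⟩, div_mul_cancel₀ b ha⟩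

theorem IsPreHField.abs_lt_of_valuation_lt (hK : IsPreHField.{u, w} K O) {a b : K}
    (h : O.valuation b < O.valuation a) : |b| < |a| := by
  by_contra! hab
  exact h.not_ge (hK.valuation_mono hab)

theorem IsPreHField.deriv_neg_of_mem_nonunits (hK : IsPreHField.{u, w} K O) {h : K}
    (hh : h ∈ O.nonunits) (h0 : 0 < h) : h′ < 0 := by
  have hinv : h⁻¹ ∉ O := (O.mem_nonunits_iff_or.1 hh).resolve_left h0.ne'
  have := hK.deriv_pos hinv (inv_pos.2 h0)
  rw [Derivation.leibniz_inv, smul_eq_mul, neg_mul, neg_pos] at this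
  exact neg_of_mul_neg_right this (sq_nonneg _)

theorem HasOrderIVP.exists_sq_eq (hIVP : HasOrderIVP K 1) {g : K} (hg : 0 < g) :
    ∃ h : K, 0 < h ∧ h ^ 2 = g := by
  obtain ⟨y, hy, -, h⟩ := hIVP (MvPolynomial.X 0 ^ 2 - MvPolynomial.C g) 0 (1 + g)
    (by positivity) (by simpa using hg) (by simp; nlinarith)
  exact ⟨y, hy, by simpa [sub_eq_zero] using h⟩

theorem HasOrderIVP.exists_deriv_eq (hIVP : HasOrderIVP K 1) {s a b : K} (hab : a < b)
    (ha : s < a′) (hb : b′ < s) : ∃ y : K, a < y ∧ y < b ∧ y′ = s := by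
  obtain ⟨y, hay, hyb, h⟩ := hIVP (MvPolynomial.C s - MvPolynomial.X 1) a b hab
    (by simpa using ha) (by simpa using hb)
  exact ⟨y, hay, hyb, (sub_eq_zero.1 (by simpa using h)).symm⟩

omit [LinearOrder K] [IsStrictOrderedRing K] in
theorem mem_integralSet_iff {y : K} :
    y ∈ integralSet O ↔ ∃ f ∈ O, O.valuation y ≤ O.valuation (f′) :=
  Iff.rfl

-- Otherwise `v s` itself would be a gap.
omit [LinearOrder K] [IsStrictOrderedRing K] in
theorem exists_valuation_le_deriv_of_not_hasGap (hgap : ¬ HasGap O) {s : K} (hs : s ≠ 0)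
    (hΨ : ∀ g : K, g ≠ 0 → O.valuation g ≠ 1 → O.valuation s < O.valuation (g′ / g)) :
    ∃ g : K, g ≠ 0 ∧ g ∈ O.nonunits ∧ O.valuation s ≤ O.valuation (g′) := by
  by_contra! hcon
  refine hgap ⟨val O s, ?_, ?_, ?_⟩
  · exact (val O).ne_top_iff.2 hs
  · rintro _ ⟨g, hg0, hg, rfl⟩
    exact hΨ g hg0 hg
  · rintro _ ⟨g, hg0, hg, rfl⟩
    rw [← AddValuation.map_mul, mul_div_cancel₀ _ hg0]
    exact hcon g hg0 hg

theorem IsPreHField.exists_nonunit_deriv_eq (hK : IsPreHField.{u, w} K O)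
    (hIVP : HasOrderIVP K 1) (hgap : ¬ HasGap O) {s : K} (hs : s ∈ integralSet O) :
    ∃ a ∈ O.nonunits, a′ = s := by
  rcases eq_or_ne s 0 with rfl | hs0
  · exact ⟨0, zero_mem _, map_zero _⟩
  obtain ⟨f, hf, hsf⟩ := mem_integralSet_iff.1 hs
  obtain ⟨g, hg0, hg, hsg⟩ := exists_valuation_le_deriv_of_not_hasGap hgap hs0
    fun g hg0 hg => hsf.trans_lt (hK.valuation_deriv_lt_of_ne_one hf hg0 hg)
  wlog hgpos : 0 < g generalizing g
  · exact this (-g) (neg_ne_zero.2 hg0) (neg_mem hg) (by rwa [map_neg, Valuation.map_neg])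
      (neg_pos.2 (lt_of_le_of_ne (not_lt.1 hgpos) hg0))
  -- The square root turns the weak bound on `s` into a strict one, hence a bound in the ordering.
  obtain ⟨h, h0, rfl⟩ := hIVP.exists_sq_eq hgpos
  have hh : h ∈ O.nonunits := by
    rw [ValuationSubring.mem_nonunits_iff, map_pow] at hg
    rw [ValuationSubring.mem_nonunits_iff]
    exact (pow_lt_one_iff two_ne_zero).1 hg
  have hneg := hK.deriv_neg_of_mem_nonunits hh h0
  have hlt : |s| < |h′| := by
    refine hK.abs_lt_of_valuation_lt (hsg.trans_lt ?_)
    have h2 : (2 : K) ∈ O := natCast_mem O 2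
    have hsq : (h ^ 2)′ = 2 * h * h′ := by
      rw [Derivation.leibniz_pow]; simp; ring
    have hpos : 0 < O.valuation (h′) := by
      rw [zero_lt_iff, Valuation.ne_zero_iff]
      exact hneg.ne
    rw [hsq, map_mul, map_mul]
    refine mul_lt_of_lt_one_left hpos ((mul_le_of_le_one_left' ?_).trans_lt hh)
    exact (O.valuation_le_one_iff 2).2 h2
  rw [abs_of_neg hneg, abs_lt] at hlt
  obtain ⟨y, hy1, hy2, hy⟩ := hIVP.exists_deriv_eq (s := s) (a := -h) (b := h) (by linarith)
    (by rw [map_neg]; exact hlt.2) (by linarith)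
  refine ⟨y, ?_, hy⟩
  have : O.valuation y ≤ O.valuation h :=
    hK.valuation_mono (by rw [abs_of_pos h0]; exact abs_le.2 ⟨hy1.le, hy2.le⟩)
  exact this.trans_lt hh

theorem IsPreHField.exists_const_add_nonunit (hK : IsPreHField.{u, w} K O)
    (hIVP : HasOrderIVP K 1) (hgap : ¬ HasGap O) {f : K} (hf : f ∈ O) :
    ∃ c : K, c′ = 0 ∧ ∃ e ∈ O.nonunits, f = c + e := by
  obtain ⟨e, he, hef⟩ := hK.exists_nonunit_deriv_eq hIVP hgap
    (mem_integralSet_iff.2 ⟨f, hf, le_rfl⟩)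
  exact ⟨f - e, by rw [map_sub, hef, sub_self], e, he, by ring⟩

theorem IsPreHField.eq_constHull (hK : IsPreHField.{u, w} K O)
    (hIVP : HasOrderIVP K 1) (hgap : ¬ HasGap O) : O = constHull K := by
  ext f
  constructor
  · intro hf
    obtain ⟨c, hc, e, he, rfl⟩ := hK.exists_const_add_nonunit hIVP hgap hf
    have he1 : |e| < |1| := hK.abs_lt_of_valuation_lt (by rwa [map_one])
    rw [abs_one] at he1
    exact mem_constHull_iff.2 ⟨|c| + 1, by simp [abs_deriv_eq_zero hc],
      (abs_add_le c e).trans (by gcongr)⟩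
  · intro hf
    obtain ⟨c, hc, h⟩ := mem_constHull_iff.1 hf
    exact hK.mem_of_abs_le (hK.mem_of_deriv_eq_zero hc) (h.trans (le_abs_self c))

end PreHField

end HFieldIVP

theorem lemma1p2 {K : Type u} [Field K] [LinearOrder K] [IsStrictOrderedRing K]
    [Differential K] (O : ValuationSubring K)
    (hK : HFieldIVP.IsPreHField.{u, w} K O)
    (hIVP : HFieldIVP.HasOrderIVP K 1)
    (hgap : ¬ HFieldIVP.HasGap O) :
    HFieldIVP.IsHField K ∧ O = HFieldIVP.constHull K ∧
      HFieldIVP.integralSet O = (fun a : K => a′) '' (O.nonunits : Set K) := by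
  have hO := hK.eq_constHull hIVP hgap
  refine ⟨⟨fun a ha => hK.deriv_pos (fun haO => ?_) (ha 0 (map_zero _)), fun a ha => ?_⟩, hO, ?_⟩
  · rw [hO] at haO
    obtain ⟨-, d, -, hd, -, had⟩ := haO
    exact (ha d hd).not_ge had
  · rw [← hO] at ha ⊢
    exact hK.exists_const_add_nonunit hIVP hgap ha
  · ext s
    constructor
    · intro hs
      exact hK.exists_nonunit_deriv_eq hIVP hgap hs
    · rintro ⟨a, ha, rfl⟩
      exact HFieldIVP.mem_integralSet_iff.2 ⟨a, O.nonunits_subset ha, le_rfl⟩
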